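/- Let $K$ be an algebraically closed field of characteristic zero and let $n\ge d\ge 3$. Let $R_{d,n}=K[z_\alpha : \alpha\in\mathbf N^{n+1},\ |\alpha|=d]$ be the coordinate ring of the affine space $X_{d,n}$ of homogeneous polynomials $f=\sum_\alpha z_\alpha x^\alpha$ of degree $d$ in $x_0,\dots,x_n$. Consider the following ideals of $R_{d,n}$. (1) $J_{d,n}$ is the defining ideal of the variety $Y_{d,n}\subset X_{d,n}$ (the affine cone over the Chow variety) of all $f$ which are products of $d$ linear forms, i.e. the ideal of all elements of $R_{d,n}$ that vanish on $Y_{d,n}$. (2) $L_{d,n}$ is the ideal generated by Brill's equations, defined as follows. For homogeneous $g$ of degree $d$ let $g_{i,d-i}(x,y)$ be the part of $g(x+y)$ of bidegree $(i,d-i)$ in $(x,y)$, and for $g,h$ homogeneous of degree $d$ put $$(g\odot h)(x,y)=\sum_{k=0}^d(-1)^k\,k!\,(d-k)!\;g_{d-k,k}(x,y)\,h_{k,d-k}(x,y).$$ Let $f$ be the generic form, let $E_j(x,w)=f_{j,d-j}(x,w)f(w)^{j-1}$ for $1\le j\le d$, and let $Q(x,w)=P_d(E_1,\dots,E_d)$,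 where $P_d$ is the polynomial expressing the $d$-th power sum through the elementary symmetric functions. Brill's equations are the coefficients, with respect to the variables $x,y,w$, of $f\odot Q(\cdot,w)$ (with $\odot$ formed in the first set of variables); they are homogeneous of degree $d+1$ in the $z_\alpha$. (3) $I_{d,n,d+1}$ is the ideal generated by the $(d+1)\times(d+1)$ minors of the matrix over $R_{d,n}$ with columns indexed by $0\le i\le n$ and rows indexed by the monomials $x^\beta$ with $|\beta|=d-1$, whose entry is the coefficient of $x^\beta$ in $\partial f/\partial x_i$. Then $L_{d,n}\ne J_{d,n}$. More precisely, $I_{d,n,d+1}\subseteq J_{d,n}$ but $I_{d,n,d+1}\not\subseteq L_{d,n}$. -/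

import Mathlib

namespace Chow

open MvPolynomial

/-- The exponents `α = (α_0, …, α_n)` with `α_0 + ⋯ + α_n = d`, indexing the monomials of degree `d`
in `x_0, …, x_n`. -/
abbrev Exps (d n : ℕ) : Type :=
  ↥(Finset.finsuppAntidiag (Finset.univ : Finset (Fin (n + 1))) d)

/-- The polynomial `∑_α c_α x^α` of degree `d` in `x_0, …, x_n` with coefficients `c_α`. -/
noncomputable def formOf {S : Type*} [CommRing S] (d n : ℕ) (c : Exps d n → S) :
    MvPolynomial (Fin (n + 1)) S :=
  ∑ α : Exps d n, monomial α.1 (c α)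

/-- The coordinate ring `R = K[z_α]` of the affine space `X` of forms of degree `d` in `n + 1`
variables; `z_α` is the function "coefficient of `x^α`". -/
abbrev CoordRing (K : Type*) [Field K] (d n : ℕ) : Type _ :=
  MvPolynomial (Exps d n) K

/-- The generic form `∑_α z_α x^α`, with coefficients in the coordinate ring. -/
noncomputable def genericForm (K : Type*) [Field K] (d n : ℕ) :
    MvPolynomial (Fin (n + 1)) (CoordRing K d n) :=
  formOf d n (fun α => X α)

/-! ### The variety of products of linear forms -/

/-- The linear form `∑_j a_j x_j`. -/
noncomputable def linForm {S : Type*} [CommRing S] {n : ℕ} (a : Fin (n + 1) → S) :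
    MvPolynomial (Fin (n + 1)) S :=
  ∑ j, C (a j) * X j

/-- The variety `Y` of forms of degree `d` (given by their coefficients) that are products of `d`
linear forms. -/
def chowVariety (K : Type*) [Field K] (d n : ℕ) : Set (Exps d n → K) :=
  {c | ∃ l : Fin d → Fin (n + 1) → K, formOf d n c = ∏ i, linForm (l i)}

/-- The defining ideal `J` of `Y`: all polynomial functions on the space of forms that vanish
on `Y`. -/
noncomputable def chowIdeal (K : Type*) [Field K] (d n : ℕ) : Ideal (CoordRing K d n) :=
  vanishingIdeal K (chowVariety K d n)

/-! ### Brill's equations -/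

/-- `polar g i x y` is the coefficient of `T ^ i` in `g (T x + y)`; for `g` homogeneous of degree
`d` it is the part of `g (x + y)` of bidegree `(i, d - i)` in `(x, y)`. -/
noncomputable def polar {σ S B : Type*} [CommRing S] [CommRing B] [Algebra S B]
    (g : MvPolynomial σ S) (i : ℕ) (x y : σ → B) : B :=
  (aeval (fun j => Polynomial.X * Polynomial.C (x j) + Polynomial.C (y j)) g :
    Polynomial B).coeff i

/-- Newton's recursion
`p_k = e_1 p_{k-1} - e_2 p_{k-2} + ⋯ + (-1)^(k-2) e_{k-1} p_1 + (-1)^(k-1) k e_k`, which expresses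
the power sum `p_k` (`k ≥ 1`) as a polynomial in the elementary symmetric functions. -/
def powerSum {A : Type*} [CommRing A] (e : ℕ → A) : ℕ → A
  | 0 => 0
  | k + 1 => (-1) ^ k * ((k + 1 : ℕ) : A) * e (k + 1) +
      ∑ i : Fin k, (-1) ^ (i : ℕ) * e ((i : ℕ) + 1) * powerSum e (k - (i : ℕ))
termination_by k => k
decreasing_by omega

/-- For `j ≥ 1`, the polynomial `E_j (x, w) = f_{j, d-j} (x, w) * f (w) ^ (j - 1)`, where
`f_{j, d-j}` is the part of `f (x + w)` of degree `j` in `x`. It is a polynomial in `x` whose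
coefficients are polynomials in `w`. If `f = ℓ_1 ⋯ ℓ_d`, then `E_j (x, w) / f (w) ^ j` is the `j`-th
elementary symmetric function of the `ℓ_i (x) / ℓ_i (w)`. -/
noncomputable def brillE {σ S : Type*} [CommRing S] (f : MvPolynomial σ S) (j : ℕ) :
    MvPolynomial σ (MvPolynomial σ S) :=
  polar (B := MvPolynomial σ (MvPolynomial σ S)) f j X (fun s => C (X s)) * C f ^ (j - 1)

/-- `Q (x, w)`: the expression of the `d`-th power sum through the elementary symmetric functions,
evaluated at the `E_j`. It has degree `d` in `x` and `d (d - 1)` in `w`, and if `f = ℓ_1 ⋯ ℓ_d`, it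
is `∑_i ℓ_i (x) ^ d * ∏_{j ≠ i} ℓ_j (w) ^ d`. -/
noncomputable def brillQ {σ S : Type*} [CommRing S] (d : ℕ) (f : MvPolynomial σ S) :
    MvPolynomial σ (MvPolynomial σ S) :=
  powerSum (brillE f) d

/-- The vertical product `g ⊙ h` of two forms of degree `d`, a polynomial in two sets of variables
`x`, `y`. It is the bilinear operation with
`(ℓ_1 ⋯ ℓ_d) ⊙ (m_1 ⋯ m_d) = ∑_π ∏_i (ℓ_i (x) m_{π i} (y) - ℓ_i (y) m_{π i} (x))`, the sum being over
the permutations `π`; up to a scalar it is the projection of `Sym^d ⊗ Sym^d` onto the Schur functor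
of `(d, d)`, realized in `Sym^d (⋀^2)`. -/
noncomputable def verticalProduct {σ S : Type*} [CommRing S] (d : ℕ) (g h : MvPolynomial σ S) :
    MvPolynomial (σ ⊕ σ) S :=
  ∑ k ∈ Finset.range (d + 1),
    (-1) ^ k * ((k.factorial * (d - k).factorial : ℕ) : MvPolynomial (σ ⊕ σ) S) *
      polar g (d - k) (fun s => X (Sum.inl s)) (fun s => X (Sum.inr s)) *
      polar h k (fun s => X (Sum.inl s)) (fun s => X (Sum.inr s))

/-- Brill's covariant `f ⊙ Q (·, w)` of a form `f` of degree `d`; a polynomial in `x`, `y` whose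
coefficients are polynomials in `w`. -/
noncomputable def brillForm {σ S : Type*} [CommRing S] (d : ℕ) (f : MvPolynomial σ S) :
    MvPolynomial (σ ⊕ σ) (MvPolynomial σ S) :=
  verticalProduct d (map C f) (brillQ d f)

/-- The ideal `L` generated by Brill's equations, which are the coefficients of Brill's covariant of
the generic form. -/
noncomputable def brillIdeal (K : Type*) [Field K] (d n : ℕ) : Ideal (CoordRing K d n) :=
  Ideal.span {q | ∃ (a : Fin (n + 1) ⊕ Fin (n + 1) →₀ ℕ) (b : Fin (n + 1) →₀ ℕ),
    q = ((brillForm d (genericForm K d n)).coeff a).coeff b}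

/-! ### Rank equations -/

/-- The matrix of `ψ`, which sends the `i`-th basis vector to the partial derivative `∂ F / ∂ x_i`
of the generic form `F`: its entry at `(β, i)` is the coefficient of `x^β`, `|β| = d - 1`. -/
noncomputable def rankMatrix (K : Type*) [Field K] (d n : ℕ) :
    Matrix (Exps (d - 1) n) (Fin (n + 1)) (CoordRing K d n) :=
  Matrix.of fun β i => (pderiv i (genericForm K d n)).coeff β.1

/-- The ideal generated by the `r × r` minors of the matrix of `ψ`. -/
noncomputable def rankIdeal (K : Type*) [Field K] (d n r : ℕ) : Ideal (CoordRing K d n) :=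
  Ideal.span {q | ∃ (s : Fin r → Exps (d - 1) n) (t : Fin r → Fin (n + 1)),
    q = ((rankMatrix K d n).submatrix s t).det}

end Chow

/-! Choose `d + 1` of the variables and let `z_ij` be the coefficient of `x_i x_j^(d-1)`. The
functional `altCoeff` takes the alternating sum of the coefficients of the monomials `∏ z_{i,s(i)}`;
the largest ideal `N` in its kernel contains all other coordinates and every `z_ij z_kl + z_kj
z_il`. Modulo `N`, `f = ∑_j x_j^(d-1) λ_j(x)` with `λ_j(v) = ∑_i z_ij v_i`, and `λ_j(v) λ_l(v) = 0`
for every point `v`. Brill's covariant has degree `d + 1 ≥ 4` in `f`, and each factor contributes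
some `λ_j` at one of only three points `x`, `y`, `w`. Some point repeats, so `L ⊆ N`
(`coeff_brillForm_mem`). The minor with rows `x_j^(d-1)` is not in `N`: its signs cancel those of
the functional, leaving a sum of positive integers (`det_notMem_altIdeal`). The minors lie in `J`
because the derivatives of a product of `d` linear forms span at most `d` dimensions. -/

namespace Chow

open MvPolynomial

/-! ### Ideals generated by evaluations of linear forms -/

section EvalIdeal

variable {S σ ι κ : Type*} [CommRing S] [Fintype ι]

/-- The ideal generated by `N` and the values at `v` of the linear forms `∑ i, z i j * x_{c i}`. -/
noncomputable def evalIdeal (N : Ideal S) (z : ι → κ → S) (c : ι → σ) {B : Type*} [CommRing B]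
    [Algebra S B] (v : σ → B) : Ideal B :=
  Ideal.span (Set.range fun j => ∑ i, algebraMap S B (z i j) * v (c i)) ⊔ N.map (algebraMap S B)

variable (N : Ideal S) (z : ι → κ → S) (c : ι → σ)

theorem sum_mem_evalIdeal {B : Type*} [CommRing B] [Algebra S B] (v : σ → B) (j : κ) :
    ∑ i, algebraMap S B (z i j) * v (c i) ∈ evalIdeal N z c v :=
  Ideal.mem_sup_left (Ideal.subset_span ⟨j, rfl⟩)

theorem map_le_evalIdeal {B : Type*} [CommRing B] [Algebra S B] (v : σ → B) :
    N.map (algebraMap S B) ≤ evalIdeal N z c v :=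
  le_sup_right

theorem evalIdeal_le_iff {B : Type*} [CommRing B] [Algebra S B] (v : σ → B) (J : Ideal B) :
    evalIdeal N z c v ≤ J ↔ (∀ j, ∑ i, algebraMap S B (z i j) * v (c i) ∈ J) ∧
      N.map (algebraMap S B) ≤ J := by
  rw [evalIdeal, sup_le_iff, Ideal.span_le, Set.range_subset_iff]
  rfl

/-- The product `v_i v_k` is symmetric, so symmetrizing `λ_j(v) λ_l(v)` in `i`, `k` leaves only the
relations `hz`; this costs a factor 2. -/
theorem evalIdeal_sq_le (h2 : IsUnit (2 : S))
    (hz : ∀ i j k l, z i j * z k l + z k j * z i l ∈ N) {B : Type*} [CommRing B] [Algebra S B]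
    (v : σ → B) : evalIdeal N z c v ^ 2 ≤ N.map (algebraMap S B) := by
  have h2B : IsUnit (2 : B) := map_ofNat (algebraMap S B) 2 ▸ h2.map (algebraMap S B)
  rw [evalIdeal, pow_two, Ideal.sup_mul, Ideal.mul_sup]
  refine sup_le (sup_le ?_ Ideal.mul_le_right) Ideal.mul_le_left
  rw [Ideal.span_mul_span', Ideal.span_le]
  rintro _ ⟨_, ⟨j, rfl⟩, _, ⟨l, rfl⟩, rfl⟩
  simp only [SetLike.mem_coe]
  rw [← Ideal.unit_mul_mem_iff_mem _ h2B, two_mul]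
  have hs : (∑ i, algebraMap S B (z i j) * v (c i)) * (∑ i, algebraMap S B (z i l) * v (c i)) +
      (∑ i, algebraMap S B (z i j) * v (c i)) * (∑ i, algebraMap S B (z i l) * v (c i)) =
      ∑ i, ∑ k, algebraMap S B (z i j * z k l + z k j * z i l) * (v (c i) * v (c k)) := by
    rw [Finset.sum_mul_sum]
    nth_rewrite 2 [Finset.sum_comm]
    simp_rw [← Finset.sum_add_distrib]
    refine Finset.sum_congr rfl fun i _ => Finset.sum_congr rfl fun k _ => ?_
    rw [map_add, map_mul, map_mul]
    ring
  rw [hs]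
  exact Ideal.sum_mem _ fun i _ => Ideal.sum_mem _ fun k _ =>
    Ideal.mul_mem_right _ _ (Ideal.mem_map_of_mem _ (hz i j k l))

theorem map_evalIdeal_le {B B' : Type*} [CommRing B] [Algebra S B] [CommRing B'] [Algebra S B']
    (φ : B →ₐ[S] B') (v : σ → B) :
    (evalIdeal N z c v).map φ ≤ evalIdeal N z c (fun s => φ (v s)) := by
  rw [Ideal.map_le_iff_le_comap, evalIdeal_le_iff]
  refine ⟨fun j => ?_, ?_⟩
  · rw [Ideal.mem_comap, map_sum]
    simp_rw [map_mul, AlgHom.commutes]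
    exact sum_mem_evalIdeal N z c (fun s => φ (v s)) j
  · rw [Ideal.map_le_iff_le_comap]
    intro a ha
    rw [Ideal.mem_comap, Ideal.mem_comap, AlgHom.commutes]
    exact map_le_evalIdeal N z c _ (Ideal.mem_map_of_mem _ ha)

/-- Linearity: `λ_j(T x + y) = T λ_j(x) + λ_j(y)`. -/
theorem evalIdeal_X_mul_C_add_C_le {B : Type*} [CommRing B] [Algebra S B] (x y : σ → B) :
    evalIdeal N z c (fun s => Polynomial.X * Polynomial.C (x s) + Polynomial.C (y s)) ≤
      (evalIdeal N z c x ⊔ evalIdeal N z c y).map Polynomial.C := by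
  rw [evalIdeal_le_iff]
  refine ⟨fun j => ?_, ?_⟩
  · have hs : ∑ i, algebraMap S (Polynomial B) (z i j) *
        (Polynomial.X * Polynomial.C (x (c i)) + Polynomial.C (y (c i))) =
        Polynomial.X * Polynomial.C (∑ i, algebraMap S B (z i j) * x (c i)) +
          Polynomial.C (∑ i, algebraMap S B (z i j) * y (c i)) := by
      simp_rw [map_sum, Finset.mul_sum, ← Finset.sum_add_distrib, map_mul]
      refine Finset.sum_congr rfl fun i _ => ?_
      rw [IsScalarTower.algebraMap_apply S B (Polynomial B), Polynomial.algebraMap_apply,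
        Algebra.algebraMap_self_apply]
      ring
    rw [hs]
    exact Ideal.add_mem _
      (Ideal.mul_mem_left _ _ (Ideal.mem_map_of_mem _
        (Ideal.mem_sup_left (sum_mem_evalIdeal N z c x j))))
      (Ideal.mem_map_of_mem _ (Ideal.mem_sup_right (sum_mem_evalIdeal N z c y j)))
  · rw [Ideal.map_le_iff_le_comap]
    intro a ha
    rw [Ideal.mem_comap, IsScalarTower.algebraMap_apply S B (Polynomial B),
      Polynomial.algebraMap_apply, Algebra.algebraMap_self_apply]
    exact Ideal.mem_map_of_mem _ (Ideal.mem_sup_left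
      (map_le_evalIdeal N z c x (Ideal.mem_map_of_mem _ ha)))

/-- The polars of an element of the ideal of the generic point lie in the evaluation ideals. -/
theorem polar_mem {B : Type*} [CommRing B] [Algebra S B] {f : MvPolynomial σ S}
    (hf : f ∈ evalIdeal N z c (X : σ → MvPolynomial σ S)) (i : ℕ) (x y : σ → B) :
    polar f i x y ∈ evalIdeal N z c x ⊔ evalIdeal N z c y := by
  have h := map_evalIdeal_le N z c
    (aeval (fun s => Polynomial.X * Polynomial.C (x s) + Polynomial.C (y s)) :
      MvPolynomial σ S →ₐ[S] Polynomial B) X (Ideal.mem_map_of_mem _ hf)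
  simp only [aeval_X] at h
  exact Ideal.mem_map_C_iff.1 (evalIdeal_X_mul_C_add_C_le N z c x y h) i

theorem aeval_mem_evalIdeal {B : Type*} [CommRing B] [Algebra S B] {f : MvPolynomial σ S}
    (hf : f ∈ evalIdeal N z c (X : σ → MvPolynomial σ S)) (x : σ → B) :
    aeval x f ∈ evalIdeal N z c x := by
  have h := map_evalIdeal_le N z c (aeval x : MvPolynomial σ S →ₐ[S] B) X
    (Ideal.mem_map_of_mem _ hf)
  simpa only [aeval_X] using h

end EvalIdeal

/-! ### Brill's covariant lies in a high power of an evaluation ideal -/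

/-- The power sum is isobaric of weight `k` when `e_j` has weight `j`. -/
theorem powerSum_mem_pow {A : Type*} [CommRing A] (I : Ideal A) (e : ℕ → A)
    (he : ∀ j, e (j + 1) ∈ I ^ (j + 1)) (k : ℕ) : powerSum e k ∈ I ^ k := by
  induction k using Nat.strong_induction_on with
  | _ k ih =>
    cases k with
    | zero => simp
    | succ k =>
      rw [powerSum]
      refine Ideal.add_mem _ (Ideal.mul_mem_left _ _ (he k)) (Ideal.sum_mem _ fun i _ => ?_)
      have hi : k + 1 = (i + 1) + (k - i) := by omega
      rw [hi, pow_add, mul_assoc]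
      exact Ideal.mul_mem_left _ _ (Ideal.mul_mem_mul (he i) (ih _ (by omega)))

/-- Pigeonhole: each monomial of degree 4 in three letters contains a square. The expansion is an
identity in the semiring of ideals. -/
theorem sup_pow_four_le {A : Type*} [CommRing A] {a b c M : Ideal A} (ha : a ^ 2 ≤ M)
    (hb : b ^ 2 ≤ M) (hc : c ^ 2 ≤ M) : (a ⊔ b ⊔ c) ^ 4 ≤ M := by
  have h : (a + b + c) ^ 4 = a ^ 2 * (a ^ 2 + 4 * a * b + 4 * a * c + 6 * b ^ 2 + 12 * b * c +
      6 * c ^ 2) + b ^ 2 * (4 * a * b + 12 * a * c + b ^ 2 + 4 * b * c + 6 * c ^ 2) +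
      c ^ 2 * (12 * a * b + 4 * a * c + 4 * b * c + c ^ 2) := by ring
  rw [← Ideal.add_eq_sup, ← Ideal.add_eq_sup, h]
  exact sup_le (sup_le (Ideal.mul_le_left.trans ha) (Ideal.mul_le_left.trans hb))
    (Ideal.mul_le_left.trans hc)

section Brill

variable {S σ ι κ : Type*} [CommRing S] [Fintype ι] (N : Ideal S) (z : ι → κ → S) (c : ι → σ)

theorem brillE_mem_pow {f : MvPolynomial σ S}
    (hf : f ∈ evalIdeal N z c (X : σ → MvPolynomial σ S)) (j : ℕ) :
    brillE f (j + 1) ∈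
      (evalIdeal N z c (X : σ → MvPolynomial σ (MvPolynomial σ S)) ⊔
        evalIdeal N z c (fun s => (C (X s) : MvPolynomial σ (MvPolynomial σ S)))) ^ (j + 1) := by
  have hC : (C f : MvPolynomial σ (MvPolynomial σ S)) = aeval (fun s => C (X s)) f := by
    have h : (IsScalarTower.toAlgHom S (MvPolynomial σ S) (MvPolynomial σ (MvPolynomial σ S))) =
        aeval (fun s => C (X s)) := by
      ext s
      simp [algebraMap_eq]
    exact DFunLike.congr_fun h f
  rw [brillE, Nat.add_sub_cancel, pow_succ']
  refine Ideal.mul_mem_mul (polar_mem N z c hf _ _ _) (Ideal.pow_mem_pow (Ideal.mem_sup_right ?_) _)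
  rw [hC]
  exact aeval_mem_evalIdeal N z c hf _

theorem evalIdeal_C_le {B : Type*} [CommRing B] [Algebra S B] (w : σ → B) :
    evalIdeal N z c (fun s => Polynomial.C (w s)) ≤ (evalIdeal N z c w).map Polynomial.C := by
  rw [evalIdeal_le_iff, IsScalarTower.algebraMap_eq S B (Polynomial B), ← Ideal.map_map]
  refine ⟨fun j => ?_, Ideal.map_mono (map_le_evalIdeal N z c w)⟩
  have hs : ∑ i, ((algebraMap B (Polynomial B)).comp (algebraMap S B)) (z i j) *
      Polynomial.C (w (c i)) = Polynomial.C (∑ i, algebraMap S B (z i j) * w (c i)) := by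
    rw [map_sum]
    refine Finset.sum_congr rfl fun i _ => ?_
    rw [map_mul]
    rfl
  rw [hs]
  exact Ideal.mem_map_of_mem _ (sum_mem_evalIdeal N z c w j)

/-- Polarizing replaces only the main variables by `T x + y`; the parameter `w` stays fixed and
supplies the third evaluation ideal. -/
theorem polar_mem_pow {S' B : Type*} [CommRing S'] [Algebra S S'] [CommRing B] [Algebra S B]
    [Algebra S' B] [IsScalarTower S S' B] {g : MvPolynomial σ S'} {w : σ → S'} {k : ℕ}
    (hg : g ∈ (evalIdeal N z c (X : σ → MvPolynomial σ S') ⊔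
      evalIdeal N z c (fun s => (C (w s) : MvPolynomial σ S'))) ^ k) (i : ℕ) (x y : σ → B) :
    polar g i x y ∈ (evalIdeal N z c x ⊔ evalIdeal N z c y ⊔
      evalIdeal N z c (fun s => algebraMap S' B (w s))) ^ k := by
  let φ : MvPolynomial σ S' →ₐ[S'] Polynomial B :=
    aeval fun s => Polynomial.X * Polynomial.C (x s) + Polynomial.C (y s)
  have hφ : (evalIdeal N z c (X : σ → MvPolynomial σ S') ⊔
      evalIdeal N z c (fun s => (C (w s) : MvPolynomial σ S'))).map (φ.restrictScalars S) ≤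
      (evalIdeal N z c x ⊔ evalIdeal N z c y ⊔
        evalIdeal N z c (fun s => algebraMap S' B (w s))).map Polynomial.C := by
    rw [Ideal.map_sup]
    refine sup_le ((map_evalIdeal_le N z c _ _).trans ?_) ((map_evalIdeal_le N z c _ _).trans ?_)
    · have h : (fun s => φ.restrictScalars S (X s)) =
          fun s => Polynomial.X * Polynomial.C (x s) + Polynomial.C (y s) := funext fun s => by
        rw [AlgHom.restrictScalars_apply, aeval_X]
      rw [h]
      exact (evalIdeal_X_mul_C_add_C_le N z c x y).trans (Ideal.map_mono le_sup_left)
    · have h : (fun s => φ.restrictScalars S (C (w s))) =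
          fun s => Polynomial.C (algebraMap S' B (w s)) := funext fun s => by
        rw [AlgHom.restrictScalars_apply, ← algebraMap_eq, φ.commutes, Polynomial.algebraMap_apply]
      rw [h]
      exact (evalIdeal_C_le N z c _).trans (Ideal.map_mono le_sup_right)
  have h := Ideal.mem_map_of_mem (φ.restrictScalars S) hg
  rw [Ideal.map_pow] at h
  have h' := Ideal.pow_right_mono hφ k h
  rw [← Ideal.map_pow] at h'
  exact Ideal.mem_map_C_iff.1 h' i

theorem brillForm_mem_pow {f : MvPolynomial σ S}
    (hf : f ∈ evalIdeal N z c (X : σ → MvPolynomial σ S)) (d : ℕ) :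
    brillForm d f ∈
      (evalIdeal N z c (fun s => (X (Sum.inl s) : MvPolynomial (σ ⊕ σ) (MvPolynomial σ S))) ⊔
        evalIdeal N z c (fun s => (X (Sum.inr s) : MvPolynomial (σ ⊕ σ) (MvPolynomial σ S))) ⊔
        evalIdeal N z c (fun s => (C (X s) : MvPolynomial (σ ⊕ σ) (MvPolynomial σ S))))
          ^ (d + 1) := by
  set A := MvPolynomial (σ ⊕ σ) (MvPolynomial σ S)
  set x : σ → A := fun s => X (Sum.inl s)
  set y : σ → A := fun s => X (Sum.inr s)
  set w : σ → A := fun s => C (X s)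
  set J : Ideal A := evalIdeal N z c x ⊔ evalIdeal N z c y ⊔ evalIdeal N z c w
  have hf' (k : ℕ) : polar (map C f : MvPolynomial σ (MvPolynomial σ S)) k x y ∈ J := by
    have h : polar (map C f : MvPolynomial σ (MvPolynomial σ S)) k x y = polar f k x y := by
      rw [polar, polar]
      congr 1
      exact aeval_map_algebraMap (A := MvPolynomial σ S)
        (fun s => Polynomial.X * Polynomial.C (x s) + Polynomial.C (y s)) f
    rw [h]
    exact Ideal.mem_sup_left (polar_mem N z c hf _ _ _)
  have hQ (k : ℕ) : polar (brillQ d f) k x y ∈ J ^ d :=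
    polar_mem_pow N z c (powerSum_mem_pow _ _ (brillE_mem_pow N z c hf) d) k x y
  rw [brillForm, verticalProduct]
  refine Ideal.sum_mem _ fun k _ => ?_
  rw [mul_assoc, pow_succ']
  exact Ideal.mul_mem_left _ _ (Ideal.mul_mem_mul (hf' _) (hQ _))

theorem coeff_brillForm_mem (h2 : IsUnit (2 : S))
    (hz : ∀ i j k l, z i j * z k l + z k j * z i l ∈ N) {f : MvPolynomial σ S}
    (hf : f ∈ evalIdeal N z c (X : σ → MvPolynomial σ S)) {d : ℕ} (hd : 3 ≤ d)
    (a : σ ⊕ σ →₀ ℕ) (b : σ →₀ ℕ) : ((brillForm d f).coeff a).coeff b ∈ N := by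
  have h := Ideal.pow_le_pow_right (show 4 ≤ d + 1 by omega) (brillForm_mem_pow N z c hf d)
  have h' := sup_pow_four_le (evalIdeal_sq_le N z c h2 hz _) (evalIdeal_sq_le N z c h2 hz _)
    (evalIdeal_sq_le N z c h2 hz _) h
  rw [IsScalarTower.algebraMap_eq S (MvPolynomial σ S)
    (MvPolynomial (σ ⊕ σ) (MvPolynomial σ S)), ← Ideal.map_map] at h'
  -- An ideal extended from the base ring is tested coefficientwise, once for `x`, `y` and once for
  -- `w`.
  exact mem_map_C_iff.1 (mem_map_C_iff.1 h' a) b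

end Brill

/-! ### The alternating functional -/

section Alternating

variable {K τ ι : Type*} [Field K] [Fintype ι]

/-- The exponent of `∏ i, X (e i (s i))`. -/
noncomputable def permExp (e : ι → ι → τ) (s : Equiv.Perm ι) : τ →₀ ℕ :=
  ∑ i, Finsupp.single (e i (s i)) 1

theorem mem_support_permExp {e : ι → ι → τ} {s : Equiv.Perm ι} {t : τ} :
    t ∈ (permExp e s).support ↔ ∃ i, e i (s i) = t := by
  classical
  simp [permExp, Finsupp.finsetSum_apply, Finsupp.single_apply]

theorem permExp_injective {e : ι → ι → τ} (he : Function.Injective2 e) :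
    Function.Injective (permExp e) := by
  intro s t h
  ext i
  have hi : e i (s i) ∈ (permExp e t).support := h ▸ mem_support_permExp.2 ⟨i, rfl⟩
  obtain ⟨m, hm⟩ := mem_support_permExp.1 hi
  obtain ⟨rfl, h'⟩ := he hm
  exact h'.symm

variable [DecidableEq ι]

/-- The alternating sum of the coefficients of the monomials `∏ i, X (e i (s i))`. -/
noncomputable def altCoeff (e : ι → ι → τ) : MvPolynomial τ K →ₗ[K] K :=
  ∑ s : Equiv.Perm ι, ((Equiv.Perm.sign s : ℤ) : K) • lcoeff K (permExp e s)

theorem altCoeff_apply (e : ι → ι → τ) (p : MvPolynomial τ K) :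
    altCoeff e p = ∑ s : Equiv.Perm ι, ((Equiv.Perm.sign s : ℤ) : K) * coeff (permExp e s) p := by
  simp [altCoeff]

/-- The largest ideal contained in the kernel of the alternating functional. -/
noncomputable def altIdeal (K : Type*) [Field K] (e : ι → ι → τ) : Ideal (MvPolynomial τ K) where
  carrier := {p | ∀ q, altCoeff e (p * q) = 0}
  zero_mem' q := by simp
  add_mem' hp hq r := by rw [add_mul, map_add, hp, hq, add_zero]
  smul_mem' r p hp q := by rw [smul_eq_mul, mul_comm r, mul_assoc, hp]

theorem mem_altIdeal_iff {e : ι → ι → τ} {p : MvPolynomial τ K} :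
    p ∈ altIdeal K e ↔ ∀ q, altCoeff e (p * q) = 0 :=
  Iff.rfl

theorem X_mem_altIdeal {e : ι → ι → τ} {t : τ} (ht : ∀ i j, e i j ≠ t) :
    (X t : MvPolynomial τ K) ∈ altIdeal K e := by
  classical
  intro q
  rw [altCoeff_apply]
  refine Finset.sum_eq_zero fun s _ => ?_
  rw [coeff_X_mul', if_neg, mul_zero]
  rw [mem_support_permExp]
  rintro ⟨i, hi⟩
  exact ht _ _ hi

/-- A permutation monomial is squarefree with one variable from each row, so it can absorb two
variables only from distinct rows. -/
theorem coeff_permExp_X_mul_X_mul {e : ι → ι → τ} (he : Function.Injective2 e)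
    (s : Equiv.Perm ι) (i j k l : ι) (q : MvPolynomial τ K) :
    coeff (permExp e s) (X (e i j) * (X (e k l) * q)) =
      if i ≠ k ∧ s i = j ∧ s k = l then
        coeff (∑ m ∈ (Finset.univ.erase i).erase k, Finsupp.single (e m (s m)) 1) q else 0 := by
  classical
  rw [coeff_X_mul']
  by_cases hi : s i = j
  · have h1 : permExp e s - Finsupp.single (e i j) 1 =
        ∑ m ∈ Finset.univ.erase i, Finsupp.single (e m (s m)) 1 := by
      rw [permExp, ← Finset.add_sum_erase _ _ (Finset.mem_univ i), hi, add_tsub_cancel_left]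
    rw [if_pos (mem_support_permExp.2 ⟨i, by rw [hi]⟩), h1, coeff_X_mul']
    by_cases hk : i ≠ k ∧ s k = l
    · have hmem : k ∈ Finset.univ.erase i := by simp [hk.1.symm]
      rw [← Finset.add_sum_erase _ _ hmem, hk.2, add_tsub_cancel_left, if_pos, if_pos ⟨hk.1, hi, rfl⟩]
      simp
    · rw [if_neg, if_neg (by tauto)]
      simp only [Finsupp.mem_support_iff, Finsupp.finsetSum_apply, Finsupp.single_apply, ne_eq,
        Finset.sum_eq_zero_iff, not_forall]
      rintro ⟨m, hm, h⟩
      obtain ⟨rfl, rfl⟩ := he (by_contra fun hne => h (if_neg hne))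
      exact hk ⟨(Finset.ne_of_mem_erase hm).symm, rfl⟩
  · rw [if_neg, if_neg (by tauto)]
    rw [mem_support_permExp]
    rintro ⟨m, hm⟩
    obtain ⟨rfl, rfl⟩ := he hm
    exact hi rfl

theorem X_mul_X_add_mem_altIdeal {e : ι → ι → τ} (he : Function.Injective2 e) (i j k l : ι) :
    (X (e i j) * X (e k l) + X (e k j) * X (e i l) : MvPolynomial τ K) ∈ altIdeal K e := by
  intro q
  rw [add_mul, map_add, mul_assoc, mul_assoc, altCoeff_apply, altCoeff_apply]
  simp_rw [coeff_permExp_X_mul_X_mul he]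
  by_cases hik : i = k
  · simp [hik]
  -- Composing with the transposition of `i` and `k` matches the terms of the two sums with opposite
  -- signs.
  rw [← Equiv.sum_comp (Equiv.mulRight (Equiv.swap i k))
    (fun s => ((Equiv.Perm.sign s : ℤ) : K) * if k ≠ i ∧ s k = j ∧ s i = l then _ else 0),
    ← Finset.sum_add_distrib]
  refine Finset.sum_eq_zero fun s _ => ?_
  have hsum : ∑ m ∈ (Finset.univ.erase k).erase i,
      Finsupp.single (e m ((s * Equiv.swap i k) m)) 1 =
      ∑ m ∈ (Finset.univ.erase i).erase k, Finsupp.single (e m (s m)) 1 := by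
    rw [Finset.erase_right_comm]
    refine Finset.sum_congr rfl fun m hm => ?_
    simp only [Finset.mem_erase] at hm
    rw [Equiv.Perm.mul_apply, Equiv.swap_apply_of_ne_of_ne hm.2.1 hm.1]
  simp only [Equiv.coe_mulRight, hsum]
  simp only [Equiv.Perm.mul_apply, Equiv.swap_apply_left, Equiv.swap_apply_right,
    Equiv.Perm.sign_mul, Equiv.Perm.sign_swap hik, ne_eq, hik, Ne.symm hik, not_false_eq_true,
    true_and]
  by_cases h : s i = j ∧ s k = l
  · simp [h]
  · rw [if_neg h]
    simp

theorem det_notMem_altIdeal [CharZero K] {e : ι → ι → τ} (he : Function.Injective2 e)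
    (r : ι → ι → ℕ) (hr : ∀ i j, r i j ≠ 0) :
    (Matrix.of fun j i => ((r i j : ℕ) : MvPolynomial τ K) * X (e i j)).det ∉ altIdeal K e := by
  classical
  intro h
  have h1 := mem_altIdeal_iff.1 h 1
  have hprod (s : Equiv.Perm ι) :
      ∏ i, (((r i (s i) : ℕ) : MvPolynomial τ K) * X (e i (s i))) =
        monomial (permExp e s) (((∏ i, r i (s i) : ℕ) : K)) := by
    rw [Finset.prod_mul_distrib, ← Nat.cast_prod, permExp, monomial_sum_index, map_natCast]
    rfl
  rw [mul_one, altCoeff_apply, Matrix.det_apply] at h1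
  have h2 (s : Equiv.Perm ι) : ((Equiv.Perm.sign s : ℤ) : K) * coeff (permExp e s)
      (∑ t : Equiv.Perm ι, Equiv.Perm.sign t • ∏ i, (Matrix.of fun j i =>
        ((r i j : ℕ) : MvPolynomial τ K) * X (e i j)) (t i) i) = ((∏ i, r i (s i) : ℕ) : K) := by
    simp only [Matrix.of_apply, hprod]
    rw [coeff_sum, Finset.sum_eq_single s]
    · rcases Int.units_eq_one_or (Equiv.Perm.sign s) with h | h <;> simp [h]
    · intro t _ hts
      have : permExp e t ≠ permExp e s := fun h => hts (permExp_injective he h)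
      rcases Int.units_eq_one_or (Equiv.Perm.sign t) with h | h <;>
        simp [h, coeff_monomial, this]
    · simp
  simp_rw [h2] at h1
  rw [← Nat.cast_sum, Nat.cast_eq_zero, Finset.sum_eq_zero_iff] at h1
  exact Finset.prod_ne_zero_iff.2 (fun i _ => hr i _) (h1 1 (Finset.mem_univ _))

end Alternating

/-! ### Forms and their derivatives -/

theorem coeff_formOf {S : Type*} [CommRing S] {d n : ℕ} (c : Exps d n → S) (α : Exps d n) :
    (formOf d n c).coeff α.1 = c α := by
  classical
  rw [formOf, coeff_sum, Finset.sum_eq_single α]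
  · simp
  · intro β _ h
    rw [coeff_monomial, if_neg fun h' => h (Subtype.ext h')]
  · simp

theorem map_formOf {S T : Type*} [CommRing S] [CommRing T] {d n : ℕ} (c : Exps d n → S)
    (φ : S →+* T) : map φ (formOf d n c) = formOf d n fun α => φ (c α) := by
  simp [formOf, map_monomial]

theorem pderiv_linForm {S : Type*} [CommRing S] {n : ℕ} (a : Fin (n + 1) → S) (i : Fin (n + 1)) :
    pderiv i (linForm a) = C (a i) := by
  classical
  simp [linForm, map_sum, pderiv_X, Pi.single_apply]

theorem pderiv_prod_linForm {S : Type*} [CommRing S] {d n : ℕ} (l : Fin d → Fin (n + 1) → S)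
    (i : Fin (n + 1)) :
    pderiv i (∏ k, linForm (l k)) = ∑ k, C (l k i) * ∏ m ∈ Finset.univ.erase k, linForm (l m) := by
  classical
  have h (s : Finset (Fin d)) : pderiv i (∏ k ∈ s, linForm (l k)) =
      ∑ k ∈ s, C (l k i) * ∏ m ∈ s.erase k, linForm (l m) := by
    induction s using Finset.induction_on with
    | empty => simp
    | insert a s ha ih =>
      rw [Finset.prod_insert ha, pderiv_mul, ih, pderiv_linForm, Finset.sum_insert ha,
        Finset.erase_insert ha, Finset.mul_sum]
      congr 1
      refine Finset.sum_congr rfl fun k hk => ?_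
      have hka : a ≠ k := fun h => ha (h ▸ hk)
      rw [Finset.erase_insert_of_ne hka, Finset.prod_insert fun h => ha (Finset.mem_of_mem_erase h)]
      ring
  exact h _

theorem rankIdeal_le_chowIdeal (K : Type*) [Field K] (d n : ℕ) :
    rankIdeal K d n (d + 1) ≤ chowIdeal K d n := by
  rw [rankIdeal, Ideal.span_le]
  rintro _ ⟨s, t, rfl⟩ c ⟨l, hl⟩
  have hentry (β : Exps (d - 1) n) (i : Fin (n + 1)) : aeval c (rankMatrix K d n β i) =
      ∑ k, (∏ m ∈ Finset.univ.erase k, linForm (l m)).coeff β.1 * l k i := by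
    have h : map (aeval c : CoordRing K d n →ₐ[K] K).toRingHom (genericForm K d n) =
        ∏ k, linForm (l k) := by
      rw [← hl, genericForm, map_formOf]
      simp
    have h' : aeval c (rankMatrix K d n β i) = (pderiv i (∏ k, linForm (l k))).coeff β.1 := by
      rw [← h, pderiv_map, coeff_map]
      rfl
    rw [h', pderiv_prod_linForm, coeff_sum]
    refine Finset.sum_congr rfl fun k _ => ?_
    rw [coeff_C_mul, mul_comm]
  rw [AlgHom.map_det]
  have hfac : (aeval c : CoordRing K d n →ₐ[K] K).mapMatrix
      ((rankMatrix K d n).submatrix s t) =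
      (Matrix.of fun a k => (∏ m ∈ Finset.univ.erase k, linForm (l m)).coeff (s a).1) *
        (Matrix.of fun k b => l k (t b)) := by
    ext a b
    rw [AlgHom.mapMatrix_apply, Matrix.map_apply, Matrix.submatrix_apply, Matrix.mul_apply]
    exact hentry _ _
  rw [hfac]
  -- The matrix factors through a space of dimension `d`, so it cannot be invertible of size `d +
  -- 1`.
  by_contra hne
  have hu := Matrix.rank_of_isUnit _ ((Matrix.isUnit_iff_isUnit_det _).2 (isUnit_iff_ne_zero.2 hne))
  have hle := (Matrix.rank_mul_le_left (Matrix.of fun a k =>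
    (∏ m ∈ Finset.univ.erase k, linForm (l m)).coeff (s a).1)
      (Matrix.of fun k b => l k (t b))).trans (Matrix.rank_le_width _)
  rw [hu, Fintype.card_fin] at hle
  omega

/-! ### The minor that is not in Brill's ideal -/

section Minor

variable {d n : ℕ}

/-- The exponent of the pure power `x_j ^ d`. -/
noncomputable def pureExp (d : ℕ) (j : Fin (n + 1)) : Exps d n :=
  ⟨Finsupp.single j d, by simp [Finset.mem_finsuppAntidiag]⟩

/-- The exponent of `x_i * x_j ^ (d - 1)`. -/
noncomputable def mixedExp (hd : 3 ≤ d) (i j : Fin (n + 1)) : Exps d n :=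
  ⟨Finsupp.single i 1 + Finsupp.single j (d - 1), by
    refine Finset.mem_finsuppAntidiag.2 ⟨?_, Finset.subset_univ _⟩
    change ∑ x, (Finsupp.single i 1 x + Finsupp.single j (d - 1) x) = d
    rw [Finset.sum_add_distrib, Finsupp.univ_sum_single_apply, Finsupp.univ_sum_single_apply]
    omega⟩

/-- Since `d - 1 ≥ 2`, the index `j` is the only one with exponent at least 2. -/
theorem mixedExp_injective2 (hd : 3 ≤ d) :
    Function.Injective2 (mixedExp hd : Fin (n + 1) → Fin (n + 1) → Exps d n) := by
  intro i i' j j' h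
  have h' : Finsupp.single i 1 + Finsupp.single j (d - 1) =
      Finsupp.single i' 1 + Finsupp.single j' (d - 1) := congrArg Subtype.val h
  have hj : j = j' := by
    by_contra hne
    have := DFunLike.congr_fun h' j
    simp only [Finsupp.add_apply, Finsupp.single_apply, if_true, if_neg (Ne.symm hne)] at this
    split_ifs at this <;> omega
  subst hj
  exact ⟨Finsupp.single_left_injective one_ne_zero (add_right_cancel h'), rfl⟩

theorem genericForm_mem_evalIdeal (K : Type*) [Field K] (hd : 3 ≤ d) {m : ℕ}
    (c : Fin m → Fin (n + 1)) (hc : Function.Injective c) (N : Ideal (CoordRing K d n))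
    (hN : ∀ α, (∀ i j, mixedExp hd (c i) (c j) ≠ α) → X α ∈ N) :
    genericForm K d n ∈ evalIdeal N (fun i j => X (mixedExp hd (c i) (c j))) c
      (X : Fin (n + 1) → MvPolynomial (Fin (n + 1)) (CoordRing K d n)) := by
  classical
  let e : Fin m × Fin m → Exps d n := fun p => mixedExp hd (c p.1) (c p.2)
  have he : Function.Injective e := fun p q h =>
    Prod.ext (hc (mixedExp_injective2 hd h).1) (hc (mixedExp_injective2 hd h).2)
  rw [genericForm, formOf, ← Finset.sum_add_sum_compl (Finset.univ.image e)]
  refine Ideal.add_mem _ ?_ (Ideal.sum_mem _ fun α hα => ?_)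
  · rw [Finset.sum_image he.injOn, Fintype.sum_prod_type_right]
    refine Ideal.sum_mem _ fun j _ => ?_
    have hs : ∑ i, monomial (e (i, j)).1 (X (e (i, j)) : CoordRing K d n) =
        X (c j) ^ (d - 1) * ∑ i, algebraMap (CoordRing K d n) _
          (X (mixedExp hd (c i) (c j))) * X (c i) := by
      rw [Finset.mul_sum]
      refine Finset.sum_congr rfl fun i _ => ?_
      rw [algebraMap_eq, X_pow_eq_monomial, C_mul_X_eq_monomial, monomial_mul, one_mul]
      exact congrArg (fun a => monomial a _) (add_comm _ _)
    rw [hs]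
    exact Ideal.mul_mem_left _ _ (sum_mem_evalIdeal N _ c X j)
  · have hα' : X α ∈ N := hN α fun i j h => by
      simp only [Finset.mem_compl, Finset.mem_image, Finset.mem_univ, true_and, not_exists] at hα
      exact hα (i, j) h
    rw [← mul_one (X α), ← C_mul_monomial]
    exact Ideal.mul_mem_right _ _ (map_le_evalIdeal N _ c X (Ideal.mem_map_of_mem _ hα'))

/-- The diagonal factor `d` comes from differentiating `x_j^d`; later only its being nonzero
matters. -/
theorem rankMatrix_pureExp (K : Type*) [Field K] (hd : 3 ≤ d) (i j : Fin (n + 1)) :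
    rankMatrix K d n (pureExp (d - 1) j) i =
      ((if i = j then d else 1 : ℕ) : CoordRing K d n) * X (mixedExp hd i j) := by
  have h : (genericForm K d n).coeff ((pureExp (d - 1) j).1 + Finsupp.single i 1) =
      X (mixedExp hd i j) := by
    have he : (pureExp (d - 1) j).1 + Finsupp.single i 1 = (mixedExp hd i j).1 := add_comm _ _
    exact he ▸ coeff_formOf _ (mixedExp hd i j)
  rw [rankMatrix, Matrix.of_apply, coeff_pderiv, h]
  have h' : ((pureExp (d - 1) j).1 i + 1 : ℕ) = if i = j then d else 1 := by
    rw [pureExp, Finsupp.single_apply]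
    split_ifs <;> omega
  rw [← h']
  push_cast
  ring

theorem not_rankIdeal_le_brillIdeal (K : Type*) [Field K] [CharZero K] (hd : 3 ≤ d)
    (hn : d ≤ n) : ¬ rankIdeal K d n (d + 1) ≤ brillIdeal K d n := by
  -- This is where `d ≤ n` enters: there are at least `d + 1` variables.
  let c : Fin (d + 1) → Fin (n + 1) := Fin.castLE (by omega)
  have hc : Function.Injective c := Fin.castLE_injective _
  let e : Fin (d + 1) → Fin (d + 1) → Exps d n := fun i j => mixedExp hd (c i) (c j)
  have he : Function.Injective2 e := fun _ _ _ _ h =>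
    ⟨hc (mixedExp_injective2 hd h).1, hc (mixedExp_injective2 hd h).2⟩
  have hL : brillIdeal K d n ≤ altIdeal K e := by
    rw [brillIdeal, Ideal.span_le]
    rintro _ ⟨a, b, rfl⟩
    refine coeff_brillForm_mem (altIdeal K e) (fun i j => X (e i j)) c ?_
      (X_mul_X_add_mem_altIdeal he) ?_ hd a b
    · exact map_ofNat (C : K →+* CoordRing K d n) 2 ▸
        (isUnit_iff_ne_zero.2 (two_ne_zero (α := K))).map (C : K →+* CoordRing K d n)
    · exact genericForm_mem_evalIdeal K hd c hc _ fun α hα => X_mem_altIdeal hα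
  intro h
  refine det_notMem_altIdeal (K := K) he (fun i j => if c i = c j then d else 1) ?_
    (hL (h (Ideal.subset_span ⟨fun j => pureExp (d - 1) (c j), c, ?_⟩)))
  · intro i j
    split_ifs <;> omega
  · congr 1
    ext1 j i
    exact (rankMatrix_pureExp K hd (c i) (c j)).symm

end Minor

end Chow

theorem mainTheorem8 (K : Type*) [Field K] [IsAlgClosed K] [CharZero K] (d n : ℕ)
    (hd : 3 ≤ d) (hn : d ≤ n) :
    Chow.brillIdeal K d n ≠ Chow.chowIdeal K d n ∧
      Chow.rankIdeal K d n (d + 1) ≤ Chow.chowIdeal K d n ∧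
      ¬ Chow.rankIdeal K d n (d + 1) ≤ Chow.brillIdeal K d n := by
  have h := Chow.not_rankIdeal_le_brillIdeal K hd hn
  have h' := Chow.rankIdeal_le_chowIdeal K d n
  exact ⟨fun heq => h (heq ▸ h'), h', h⟩
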